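/- **Setting.** Let $n\ge 1$, $\Gamma=(\mathbb Z_2)^n$ with the standard scalar product $\langle g,h\rangle=\sum_i g_ih_i\in\mathbb Z_2$, and let $\gamma_1,\dots,\gamma_q$, $q=2^{n-1}$, be an enumeration of the even elements of $\Gamma$, i.e. those with $\langle g,g\rangle=0$. Let $K$ be a field of characteristic $0$ and $\mathbf r=(r_1,\dots,r_q)\in\mathbb N^q$. A purely even $\Gamma$-graded commutative algebra is an associative unital $K$-algebra $A=\bigoplus_{g\in\Gamma}A^g$ with $A^gA^h\subset A^{g+h}$, with $ba=(-1)^{\langle g,h\rangle}ab$ for $a\in A^g$, $b\in A^h$, and with $A^g=0$ for every $g$ that is not even; then $A^0$ is a commutative ring. Let $\mathsf M^0(\mathbf r;A)$ be the algebra of $q\times q$ block matrices $X=(X_{ku})$ over $A$ in which $X_{ku}$ has size $r_k\times r_u$ and entries in $A^{-\gamma_k+\gamma_u}$. Such a matrix is block-diagonal if $X_{ku}=0$ for $k\ne u$, and upper (lower) block-unitriangular if all $X_{kk}$ are identity matrices and $X_{ku}=0$ for $k>u$ (for $k<u$). For a map $f:\mathsf M^0(\mathbf r;A)\to A^0$ consider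 the conditions 1. $f(XY)=f(X)f(Y)$ for all $X,Y$; 2. $f(X)=\prod_{k=1}^q\det(X_{kk})$ if $X$ is block-diagonal; 3. $f(X)=1$ if $X$ is upper or lower block-unitriangular. Call $f$ linear in the rows (columns) if it is $A^0$-linear in each row (column) when the other rows (columns) are fixed, and polynomial if $f(X)$ is the value at the entries of $X$ of one fixed noncommutative polynomial with coefficients in $K$. **Theorem.** There is a noncommutative polynomial $p$ with coefficients in $K$, depending only on $K$, $n$, $\mathbf r$ and $(\gamma_k)$, such that for every purely even $\Gamma$-graded commutative algebra $A$ over $K$ there is a map $\Gamma\mathrm{det}:\mathsf M^0(\mathbf r;A)\to A^0$ with the following properties. (i) $\Gamma\mathrm{det}$ satisfies (1), (2), (3), and it is unique in the following senses. * Every map that satisfies (1), (2), (3) and is linear in the rows, or linear in the columns, or polynomial, equals $\Gamma\mathrm{det}$. * If $A^0$ is reduced (has no nonzero nilpotent element), every map that satisfies (1), (2), (3) equals $\Gamma\mathrm{det}$. * For every $A$, every map that satisfies (1), (2), (3) agrees with $\Gamma\mathrm{det}$ at each $X$ that has a block UDL decomposition, i.e. $X=UDL$ in $\mathsf M^0(\mathbf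 r;A)$ with $U$ upper block-unitriangular, $D$ block-diagonal and $L$ lower block-unitriangular. (ii) $\Gamma\mathrm{det}$ is linear in the rows and linear in the columns, and it is polynomial: $\Gamma\mathrm{det}(X)$ is the value of $p$ at the entries of $X$. -/

import Mathlib

open scoped Matrix

namespace GradedDet

/-- The group `(ℤ/2)^n`. -/
abbrev Deg (n : ℕ) : Type := Fin n → ZMod 2

/-- The even elements of `(ℤ/2)^n`: those with `⟨g, g⟩ = 0` for the standard scalar product. -/
abbrev EvenDeg (n : ℕ) : Type := {g : Deg n // g ⬝ᵥ g = 0}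

section Algebra

variable {K A : Type*} [Field K] [Ring A] [Algebra K A] {n : ℕ}

/-- Graded commutativity: `b * a = (-1)^⟨deg a, deg b⟩ a * b` for homogeneous `a`, `b`. -/
class GradedCommutative (𝒜 : Deg n → Submodule K A) [GradedAlgebra 𝒜] : Prop where
  comm : ∀ (g h : Deg n) (a b : A), a ∈ 𝒜 g → b ∈ 𝒜 h →
    b * a = (-1 : A) ^ (g ⬝ᵥ h).val * (a * b)

/-- The graded algebra has no nonzero homogeneous element of odd degree. -/
def PurelyEven (𝒜 : Deg n → Submodule K A) : Prop :=
  ∀ g : Deg n, g ⬝ᵥ g ≠ 0 → 𝒜 g = ⊥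

/-- The degree-zero part of a graded commutative algebra is a commutative ring. -/
instance instCommRingZero (𝒜 : Deg n → Submodule K A) [GradedAlgebra 𝒜]
    [GradedCommutative 𝒜] : CommRing (𝒜 0) :=
  { (inferInstance : Ring (𝒜 0)) with
    mul_comm := fun a b => by
      apply Subtype.ext
      have h := GradedCommutative.comm (𝒜 := 𝒜) 0 0 b a b.2 a.2
      simpa using h }

/-- Row and column indices of a block matrix with `q` block rows of heights `r 0, r 1, …`. -/
abbrev Idx {q : ℕ} (r : Fin q → ℕ) : Type := Σ k : Fin q, Fin (r k)

/-- The algebra of degree-`0` graded matrices of rank `r`, for an enumeration `γ` of the even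
elements: the entries of the block `(k, u)` have degree `-γ k + γ u`. -/
def M0 (𝒜 : Deg n → Submodule K A) [GradedAlgebra 𝒜] {q : ℕ} (γ : Fin q ≃ EvenDeg n)
    (r : Fin q → ℕ) : Subalgebra K (Matrix (Idx r) (Idx r) A) where
  carrier := {X | ∀ i j, X i j ∈ 𝒜 (-(γ i.1 : Deg n) + (γ j.1 : Deg n))}
  mul_mem' := by
    intro X Y hX hY i j
    rw [Matrix.mul_apply]
    refine Submodule.sum_mem _ fun k _ => ?_
    have h := SetLike.mul_mem_graded (hX i k) (hY k j)
    rwa [show -(γ i.1 : Deg n) + (γ k.1 : Deg n) + (-(γ k.1 : Deg n) + (γ j.1 : Deg n))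
      = -(γ i.1 : Deg n) + (γ j.1 : Deg n) by abel] at h
  add_mem' := by
    intro X Y hX hY i j
    exact Submodule.add_mem _ (hX i j) (hY i j)
  algebraMap_mem' := by
    intro c i j
    rw [Matrix.algebraMap_matrix_apply]
    split_ifs with h
    · subst h
      rw [neg_add_cancel]
      exact SetLike.algebraMap_mem_graded 𝒜 c
    · exact Submodule.zero_mem _

variable {𝒜 : Deg n → Submodule K A} [GradedAlgebra 𝒜] {q : ℕ} {γ : Fin q ≃ EvenDeg n}
  {r : Fin q → ℕ}

/-- The diagonal block `X_kk`, a matrix with entries in the degree-zero part. -/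
def diagBlock (X : M0 𝒜 γ r) (k : Fin q) : Matrix (Fin (r k)) (Fin (r k)) (𝒜 0) :=
  fun i j => ⟨(X : Matrix (Idx r) (Idx r) A) ⟨k, i⟩ ⟨k, j⟩, by
    have h := X.2 ⟨k, i⟩ ⟨k, j⟩
    rwa [neg_add_cancel] at h⟩

/-- All off-diagonal blocks vanish. -/
def IsBlockDiagonal (X : M0 𝒜 γ r) : Prop :=
  ∀ i j : Idx r, i.1 ≠ j.1 → (X : Matrix (Idx r) (Idx r) A) i j = 0

/-- Identity diagonal blocks, and zero blocks below the diagonal. -/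
def IsUpperUnitriangular (X : M0 𝒜 γ r) : Prop :=
  (∀ k, diagBlock X k = 1) ∧
    ∀ i j : Idx r, j.1 < i.1 → (X : Matrix (Idx r) (Idx r) A) i j = 0

/-- Identity diagonal blocks, and zero blocks above the diagonal. -/
def IsLowerUnitriangular (X : M0 𝒜 γ r) : Prop :=
  (∀ k, diagBlock X k = 1) ∧
    ∀ i j : Idx r, i.1 < j.1 → (X : Matrix (Idx r) (Idx r) A) i j = 0

/-- `X` admits a block UDL decomposition inside the degree-`0` graded matrices. -/
def HasUDL (X : M0 𝒜 γ r) : Prop :=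
  ∃ U D L : M0 𝒜 γ r, IsUpperUnitriangular U ∧ IsBlockDiagonal D ∧ IsLowerUnitriangular L ∧
    X = U * D * L

/-- The three characterizing conditions on a graded determinant. -/
structure IsGradedDet [GradedCommutative 𝒜] (f : M0 𝒜 γ r → 𝒜 0) : Prop where
  map_mul : ∀ X Y, f (X * Y) = f X * f Y
  blockDiagonal : ∀ X, IsBlockDiagonal X → f X = ∏ k, (diagBlock X k).det
  unitriangular : ∀ X, IsUpperUnitriangular X ∨ IsLowerUnitriangular X → f X = 1

/-- `f` is linear over the degree-zero part in each row, the other rows being fixed. -/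
def LinearInRows (f : M0 𝒜 γ r → 𝒜 0) : Prop :=
  ∀ (i : Idx r) (a b : 𝒜 0) (X Y Z : M0 𝒜 γ r),
    (∀ k, k ≠ i → ∀ j, Z.1 k j = X.1 k j ∧ Z.1 k j = Y.1 k j) →
    (∀ j, Z.1 i j = (a : A) * X.1 i j + (b : A) * Y.1 i j) →
    f Z = a * f X + b * f Y

/-- `f` is linear over the degree-zero part in each column, the other columns being fixed. -/
def LinearInColumns (f : M0 𝒜 γ r → 𝒜 0) : Prop :=
  ∀ (j : Idx r) (a b : 𝒜 0) (X Y Z : M0 𝒜 γ r),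
    (∀ k, k ≠ j → ∀ i, Z.1 i k = X.1 i k ∧ Z.1 i k = Y.1 i k) →
    (∀ i, Z.1 i j = (a : A) * X.1 i j + (b : A) * Y.1 i j) →
    f Z = a * f X + b * f Y

/-- `f` is given by the (noncommutative) polynomial `p` in the matrix entries. -/
def IsGivenBy (p : FreeAlgebra K (Idx r × Idx r)) (f : M0 𝒜 γ r → 𝒜 0) : Prop :=
  ∀ X : M0 𝒜 γ r, ((f X : 𝒜 0) : A) = FreeAlgebra.lift K (fun e => X.1 e.1 e.2) p

end Algebra

end GradedDet

/-!
Existence. On even degrees the scalar product is the antisymmetrization of a bilinear form `twist`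
(`twist_add_twist_swap`), so the product `a ∘ b = (-1)^(twist g h) a b` of homogeneous elements of
even degrees `g`, `h` is commutative and associative. It is realized by a commutative algebra `Boson
𝒜` of operators on `A`, generated by the twisted left multiplications. Suitable signs on the blocks
turn a matrix of degree zero into a matrix over `Boson 𝒜` in a multiplicative way (`toBoson_mul`),
and `gradedDet` is the ordinary determinant of the latter. Its multiplicativity, its values on block
triangular matrices, its multilinearity and its Leibniz expansion are those of the ordinary
determinant.

Uniqueness. Let `f` and `g` satisfy the three conditions. They take the value `1` on transvections
and the product of the entries on diagonal matrices. A division-free elimination step with pivot `x`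
therefore multiplies both by the same power of `x` (`exists_elim`), and eliminating at all indices
shows that the product of these powers annihilates `f X - g X` (`IsGradedDet.pivotProd_mul_sub`).

If `f` and `g` are polynomial on the lines `(1 - t) 1 + t X`, as linear and polynomial maps are,
this is an identity between polynomials in `t`. The product of pivots has constant coefficient `1`,
so it cancels (`IsGradedDet.eq_of_polynomialOnLines`).

If the degree-zero part is reduced, elimination proceeds as long as a pivot does not annihilate `δ =
f X - g X`. When it is stuck at every row-equivalent matrix, each remaining entry of `δ X` has
square zero, because an entry may multiply its own row: degrees are of order two. As the twisted
product is commutative, a matrix with square-zero entries is nilpotent, whence `δ f X = δ g X = 0`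
and `δ² = 0` (`IsGradedDet.eq_of_isReduced`).
-/

namespace GradedDet

/-! ### A bilinear form that untwists the commutation sign -/

section Twist

variable {n : ℕ}

/-- The bilinear form `∑ i < j, g i * h j` on `(ℤ/2)^n`. On even degrees its antisymmetrization is
the scalar product. -/
def twist (g h : Deg n) : ZMod 2 := ∑ i, ∑ j, if i < j then g i * h j else 0

theorem twist_add_left (g g' h : Deg n) : twist (g + g') h = twist g h + twist g' h := by
  simp only [twist, ← Finset.sum_add_distrib]
  refine Finset.sum_congr rfl fun i _ => Finset.sum_congr rfl fun j _ => ?_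
  split_ifs <;> simp [add_mul]

theorem twist_add_right (g h h' : Deg n) : twist g (h + h') = twist g h + twist g h' := by
  simp only [twist, ← Finset.sum_add_distrib]
  refine Finset.sum_congr rfl fun i _ => Finset.sum_congr rfl fun j _ => ?_
  split_ifs <;> simp [mul_add]

@[simp] theorem twist_zero_left (h : Deg n) : twist 0 h = 0 := by simp [twist]

@[simp] theorem twist_zero_right (g : Deg n) : twist g 0 = 0 := by simp [twist]

theorem sum_eq_zero_of_even {g : Deg n} (hg : g ⬝ᵥ g = 0) : ∑ i, g i = 0 := by
  rw [← hg, dotProduct]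
  refine Finset.sum_congr rfl fun i _ => ?_
  generalize g i = z
  revert z
  decide

/-- Both sides differ by `(∑ i, g i) * ∑ j, h j`, and the coordinate sum of `g` equals `⟨g, g⟩`. -/
theorem twist_add_twist_swap {g : Deg n} (hg : g ⬝ᵥ g = 0) (h : Deg n) :
    twist g h + twist h g = g ⬝ᵥ h := by
  -- The three terms collect the pairs `i < j`, `j < i` and `i = j`.
  have key : twist g h + twist h g + g ⬝ᵥ h = (∑ i, g i) * ∑ j, h j := by
    have h2 : twist h g = ∑ i, ∑ j, if j < i then g i * h j else 0 := by
      rw [twist, Finset.sum_comm]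
      simp only [mul_comm]
    have h3 : g ⬝ᵥ h = ∑ i, ∑ j, if i = j then g i * h j else 0 := by
      simp [dotProduct]
    rw [h2, h3, twist, ← Finset.sum_add_distrib, ← Finset.sum_add_distrib, Finset.sum_mul_sum]
    refine Finset.sum_congr rfl fun i _ => ?_
    rw [← Finset.sum_add_distrib, ← Finset.sum_add_distrib]
    refine Finset.sum_congr rfl fun j _ => ?_
    rcases lt_trichotomy i j with hij | hij | hij
    · simp [hij, hij.not_gt, hij.ne]
    · simp [hij]
    · simp [hij, hij.not_gt, hij.ne']
  rw [sum_eq_zero_of_even hg, zero_mul] at key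
  exact CharTwo.add_eq_zero.mp key

theorem deg_add_self (g : Deg n) : g + g = 0 := by
  funext i
  exact CharTwo.add_self_eq_zero _

/-- The sign `(-1)^z` of `z : ℤ/2`. -/
def sgn (K : Type*) [Ring K] (z : ZMod 2) : K := (-1) ^ z.val

theorem sgn_add (K : Type*) [Ring K] (z w : ZMod 2) : sgn K (z + w) = sgn K z * sgn K w := by
  have hz : z = 0 ∨ z = 1 := by revert z; decide
  have hw : w = 0 ∨ w = 1 := by revert w; decide
  have h2 : (1 + 1 : ZMod 2) = 0 := by decide
  have h1 : (1 : ZMod 2).val = 1 := rfl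
  rcases hz with rfl | rfl <;> rcases hw with rfl | rfl <;> simp [sgn, h2, h1]

@[simp] theorem sgn_zero (K : Type*) [Ring K] : sgn K 0 = 1 := by simp [sgn]

theorem sgn_mul_self (K : Type*) [Ring K] (z : ZMod 2) : sgn K z * sgn K z = 1 := by
  rw [← sgn_add, CharTwo.add_self_eq_zero, sgn_zero]

end Twist

/-! ### The twisted product and matrices over it -/

section Bosonization

variable {K A : Type*} [Field K] [Ring A] [Algebra K A] {n : ℕ}
variable (𝒜 : Deg n → Submodule K A) [GradedAlgebra 𝒜]

theorem mul_comm_homogeneous [GradedCommutative 𝒜] {g h : Deg n} {a b : A} (ha : a ∈ 𝒜 g)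
    (hb : b ∈ 𝒜 h) : b * a = sgn K (g ⬝ᵥ h) • (a * b) := by
  rw [GradedCommutative.comm g h a b ha hb, Algebra.smul_def]
  simp [sgn]

theorem mul_comm_degree_zero [GradedCommutative 𝒜] (a : 𝒜 0) (b : A) : (a : A) * b = b * a := by
  induction b using DirectSum.Decomposition.inductionOn 𝒜 with
  | zero => simp
  | homogeneous b => simpa using (mul_comm_homogeneous 𝒜 a.2 b.2).symm
  | add b c hb hc => rw [mul_add, add_mul, hb, hc]

/-- The sign operator that multiplies the component of degree `h` by `(-1)^(twist g h)`. -/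
def twistOp (g : Deg n) : Module.End K A :=
  ∑ h, sgn K (twist g h) • GradedAlgebra.proj 𝒜 h

theorem twistOp_of_mem (g : Deg n) {h : Deg n} {b : A} (hb : b ∈ 𝒜 h) :
    twistOp 𝒜 g b = sgn K (twist g h) • b := by
  rw [twistOp, LinearMap.sum_apply, Finset.sum_eq_single h]
  · simp [GradedAlgebra.proj_apply, DirectSum.decompose_of_mem_same 𝒜 hb]
  · intro k _ hk
    simp [GradedAlgebra.proj_apply, DirectSum.decompose_of_mem_ne 𝒜 hb hk.symm]
  · simp

/-- Left multiplication by `a`, regarded as an element of degree `g`, for the twisted product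
`a ∘ b = (-1)^(twist g h) a b` with `b` of degree `h`. -/
def twistMul (g : Deg n) : A →ₗ[K] Module.End K A where
  toFun a := LinearMap.mulLeft K a * twistOp 𝒜 g
  map_add' a b := by ext c; simp [add_mul]
  map_smul' a b := by ext c; simp

theorem twistMul_apply_of_mem (g : Deg n) (a : A) {h : Deg n} {b : A} (hb : b ∈ 𝒜 h) :
    twistMul 𝒜 g a b = sgn K (twist g h) • (a * b) := by
  simp [twistMul, twistOp_of_mem 𝒜 g hb]

theorem twistMul_apply_one (g : Deg n) (a : A) : twistMul 𝒜 g a 1 = a := by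
  rw [twistMul_apply_of_mem 𝒜 g a SetLike.GradedOne.one_mem]
  simp

theorem twistMul_zero_apply (a b : A) : twistMul 𝒜 0 a b = a * b := by
  induction b using DirectSum.Decomposition.inductionOn 𝒜 with
  | zero => simp
  | homogeneous b => simp [twistMul_apply_of_mem 𝒜 0 a b.2]
  | add b c hb hc => rw [mul_add, map_add, hb, hc]

/-- Associativity of the twisted product: `twistMul` turns `∘` into composition of operators. -/
theorem twistMul_mul (g : Deg n) (a : A) {h : Deg n} {b : A} (hb : b ∈ 𝒜 h) :
    twistMul 𝒜 g a * twistMul 𝒜 h b = sgn K (twist g h) • twistMul 𝒜 (g + h) (a * b) := by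
  ext c
  induction c using DirectSum.Decomposition.inductionOn 𝒜 with
  | zero => simp
  | @homogeneous k c =>
    have hbc := SetLike.mul_mem_graded hb c.2
    simp only [Module.End.mul_apply, LinearMap.smul_apply, twistMul_apply_of_mem 𝒜 _ _ c.2,
      map_smul, twistMul_apply_of_mem 𝒜 _ _ hbc, smul_smul, mul_assoc, ← sgn_add,
      twist_add_left, twist_add_right]
    congr 2
    ring
  | add b c hb hc => rw [map_add, map_add, hb, hc]

theorem twistMul_commute [GradedCommutative 𝒜] {g h : Deg n} (hg : g ⬝ᵥ g = 0) {a b : A}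
    (ha : a ∈ 𝒜 g) (hb : b ∈ 𝒜 h) :
    twistMul 𝒜 g a * twistMul 𝒜 h b = twistMul 𝒜 h b * twistMul 𝒜 g a := by
  rw [twistMul_mul 𝒜 g a hb, twistMul_mul 𝒜 h b ha, mul_comm_homogeneous 𝒜 ha hb, map_smul,
    smul_smul, ← sgn_add, add_comm h g, ← twist_add_twist_swap hg h]
  congr 2
  rw [add_comm, add_assoc, CharTwo.add_self_eq_zero, add_zero]

/-- The twisted left multiplications by homogeneous elements of even degree. -/
def bosonSet : Set (Module.End K A) :=
  {φ | ∃ g : Deg n, g ⬝ᵥ g = 0 ∧ ∃ a ∈ 𝒜 g, φ = twistMul 𝒜 g a}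

/-- The algebra of operators generated by the twisted left multiplications by homogeneous elements
of even degree. It realizes the twisted product and is commutative. -/
def Boson : Subalgebra K (Module.End K A) := Algebra.adjoin K (bosonSet 𝒜)

instance instCommRingBoson [GradedCommutative 𝒜] : CommRing (Boson 𝒜) :=
  { (inferInstance : Ring (Boson 𝒜)) with
    mul_comm := (Algebra.isMulCommutative_adjoin K (s := bosonSet 𝒜) (by
      rintro _ ⟨g, hg, a, ha, rfl⟩ _ ⟨h, -, b, hb, rfl⟩
      exact twistMul_commute 𝒜 hg ha hb)).is_comm.comm }

variable {𝒜}

theorem twistMul_mem_boson {g : Deg n} (hg : g ⬝ᵥ g = 0) {a : A} (ha : a ∈ 𝒜 g) :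
    twistMul 𝒜 g a ∈ Boson 𝒜 :=
  Algebra.subset_adjoin ⟨g, hg, a, ha, rfl⟩

/-- In degree zero the twisted product is the original one, so the degree-zero part acts by ordinary
left multiplication. -/
def zeroToBoson [GradedCommutative 𝒜] : 𝒜 0 →+* Boson 𝒜 where
  toFun a := ⟨twistMul 𝒜 0 a, twistMul_mem_boson (by simp) a.2⟩
  map_one' := by
    ext b
    simpa using twistMul_zero_apply 𝒜 1 b
  map_mul' a b := by
    ext c
    simpa [twistMul_zero_apply] using mul_assoc (a : A) b c
  map_zero' := by ext; simp
  map_add' a b := by ext; simp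

theorem zeroToBoson_apply [GradedCommutative 𝒜] (a : 𝒜 0) (b : A) :
    (zeroToBoson a).1 b = a * b :=
  twistMul_zero_apply 𝒜 a b

variable {q : ℕ} {γ : Fin q ≃ EvenDeg n} {r : Fin q → ℕ}

theorem even_entry_degree (k u : EvenDeg n) :
    (-(k : Deg n) + (u : Deg n)) ⬝ᵥ (-(k : Deg n) + (u : Deg n)) = 0 := by
  simp only [add_dotProduct, dotProduct_add, neg_dotProduct, dotProduct_neg, k.2, u.2,
    dotProduct_comm (u : Deg n) (k : Deg n)]
  simp [CharTwo.add_self_eq_zero]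

/-- The matrix of twisted left multiplications by the entries of `X`. The sign `twist (γ k) (-γ k +
γ u)` in the block `(k, u)` cancels the twist of the product, which makes this map multiplicative.
-/
def toBoson (X : M0 𝒜 γ r) : Matrix (Idx r) (Idx r) (Boson 𝒜) := fun i j =>
  sgn K (twist (γ i.1 : Deg n) (-(γ i.1 : Deg n) + (γ j.1 : Deg n))) •
    ⟨twistMul 𝒜 (-(γ i.1 : Deg n) + (γ j.1 : Deg n)) (X.1 i j),
      twistMul_mem_boson (even_entry_degree _ _) (X.2 i j)⟩

theorem coe_toBoson (X : M0 𝒜 γ r) (i j : Idx r) : (toBoson X i j : Module.End K A) =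
    sgn K (twist (γ i.1 : Deg n) (-(γ i.1 : Deg n) + (γ j.1 : Deg n))) •
      twistMul 𝒜 (-(γ i.1 : Deg n) + (γ j.1 : Deg n)) (X.1 i j) := rfl

theorem toBoson_mul [GradedCommutative 𝒜] (X Y : M0 𝒜 γ r) :
    toBoson (X * Y) = toBoson X * toBoson Y := by
  ext i j : 2
  have hsum : ((toBoson X * toBoson Y) i j).1 =
      ∑ k, (toBoson X i k).1 * (toBoson Y k j).1 := by
    rw [Matrix.mul_apply]
    exact map_sum (Boson 𝒜).val _ _
  rw [hsum, coe_toBoson]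
  simp only [MulMemClass.coe_mul, Matrix.mul_apply, map_sum, Finset.smul_sum]
  refine Finset.sum_congr rfl fun k _ => ?_
  rw [coe_toBoson, coe_toBoson, smul_mul_smul_comm, twistMul_mul 𝒜 _ _ (Y.2 k j), smul_smul,
    ← sgn_add, ← sgn_add]
  generalize (γ i.1 : Deg n) = a
  generalize (γ k.1 : Deg n) = b
  generalize (γ j.1 : Deg n) = c
  have h1 : -a + b + (-b + c) = -a + c := by abel
  rw [h1]
  congr 2
  have h2 : twist a (-a + c) = twist a (-a + b) + twist a (-b + c) := by
    rw [← twist_add_right, h1]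
  have h3 : twist (-a + b) (-b + c) = twist a (-b + c) + twist b (-b + c) := by
    rw [twist_add_left, neg_eq_of_add_eq_zero_left (deg_add_self a)]
  rw [h2, h3]
  linear_combination -CharTwo.add_self_eq_zero (twist b (-b + c))

theorem toBoson_apply_one (X : M0 𝒜 γ r) (i j : Idx r) : (toBoson X i j).1 1 =
    sgn K (twist (γ i.1 : Deg n) (-(γ i.1 : Deg n) + (γ j.1 : Deg n))) • X.1 i j := by
  rw [coe_toBoson, LinearMap.smul_apply, twistMul_apply_one]

theorem eq_zero_of_toBoson_eq_zero {X : M0 𝒜 γ r} (hX : toBoson X = 0) : X = 0 := by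
  ext i j
  have h := toBoson_apply_one X i j
  rw [hX] at h
  have h' := congrArg (fun x =>
    sgn K (twist (γ i.1 : Deg n) (-(γ i.1 : Deg n) + (γ j.1 : Deg n))) • x) h
  simpa [smul_smul, sgn_mul_self] using h'.symm

theorem toBoson_same_block [GradedCommutative 𝒜] (X : M0 𝒜 γ r) (k : Fin q) (a b : Fin (r k)) :
    toBoson X ⟨k, a⟩ ⟨k, b⟩ = zeroToBoson (diagBlock X k a b) := by
  apply Subtype.ext
  rw [coe_toBoson]
  simp only [neg_add_cancel, twist_zero_right, sgn_zero, one_smul]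
  rfl

end Bosonization

/-! ### The graded determinant -/

section Existence

variable {K A : Type*} [Field K] [Ring A] [Algebra K A] {n : ℕ}
variable {𝒜 : Deg n → Submodule K A} [GradedAlgebra 𝒜]
variable {q : ℕ} {γ : Fin q ≃ EvenDeg n} {r : Fin q → ℕ}

/-- The degree of the entry `(i, j)` of a matrix in `M0 𝒜 γ r`. -/
def entryDegree (γ : Fin q ≃ EvenDeg n) (r : Fin q → ℕ) (i j : Idx r) : Deg n :=
  -(γ i.1 : Deg n) + (γ j.1 : Deg n)

/-- The degree of the product of the entries `(π i, i)` over `i` in the list `l`. -/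
def wordDegree (γ : Fin q ≃ EvenDeg n) (r : Fin q → ℕ) (π : Equiv.Perm (Idx r))
    (l : List (Idx r)) : Deg n :=
  (l.map fun i => entryDegree γ r (π i) i).sum

variable (K) in
/-- The product of the generators `(π i, i)` over `i` in the list `l`, in this order, with the sign
by which the product of the entries of `toBoson X` differs from that of the entries of `X`. -/
def detWord (γ : Fin q ≃ EvenDeg n) (r : Fin q → ℕ) (π : Equiv.Perm (Idx r)) :
    List (Idx r) → FreeAlgebra K (Idx r × Idx r)
  | [] => 1
  | i :: l => sgn K (twist (γ (π i).1 : Deg n) (entryDegree γ r (π i) i) +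
      twist (entryDegree γ r (π i) i) (wordDegree γ r π l)) •
        (FreeAlgebra.ι K (π i, i) * detWord γ r π l)

variable (K) in
/-- The Leibniz expansion of the determinant of `toBoson X`, as a noncommutative polynomial in the
entries of `X`. -/
noncomputable def detPoly (γ : Fin q ≃ EvenDeg n) (r : Fin q → ℕ) :
    FreeAlgebra K (Idx r × Idx r) :=
  ∑ π : Equiv.Perm (Idx r), Equiv.Perm.sign π • detWord K γ r π Finset.univ.toList

theorem lift_detWord_mem (X : M0 𝒜 γ r) (π : Equiv.Perm (Idx r)) (l : List (Idx r)) :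
    FreeAlgebra.lift K (fun e : Idx r × Idx r => X.1 e.1 e.2) (detWord K γ r π l) ∈
      𝒜 (wordDegree γ r π l) := by
  induction l with
  | nil => simpa [detWord, wordDegree] using SetLike.GradedOne.one_mem (A := 𝒜)
  | cons i l ih =>
    rw [detWord, map_smul, map_mul, FreeAlgebra.lift_ι_apply, wordDegree, List.map_cons,
      List.sum_cons]
    exact Submodule.smul_mem _ _ (SetLike.mul_mem_graded (X.2 _ _) ih)

theorem prod_toBoson_apply_one [GradedCommutative 𝒜] (X : M0 𝒜 γ r) (π : Equiv.Perm (Idx r))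
    (l : List (Idx r)) :
    ((l.map fun i => toBoson X (π i) i).prod).1 1 =
      FreeAlgebra.lift K (fun e : Idx r × Idx r => X.1 e.1 e.2) (detWord K γ r π l) := by
  induction l with
  | nil => simp [detWord]
  | cons i l ih =>
    have hm : ∀ φ ψ : Boson 𝒜, (φ * ψ).1 1 = φ.1 (ψ.1 1) := fun _ _ => rfl
    rw [List.map_cons, List.prod_cons, hm, ih, coe_toBoson, LinearMap.smul_apply,
      twistMul_apply_of_mem 𝒜 _ _ (lift_detWord_mem X π l), smul_smul, ← sgn_add, detWord,
      map_smul, map_mul, FreeAlgebra.lift_ι_apply]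
    rfl

theorem wordDegree_univ (π : Equiv.Perm (Idx r)) :
    wordDegree γ r π Finset.univ.toList = 0 := by
  rw [wordDegree, Finset.sum_map_toList]
  simp only [entryDegree, Finset.sum_add_distrib, Finset.sum_neg_distrib]
  rw [Equiv.sum_comp π (fun i : Idx r => (γ i.1 : Deg n)), neg_add_cancel]

theorem det_toBoson_apply_one [GradedCommutative 𝒜] (X : M0 𝒜 γ r) :
    (toBoson X).det.1 1 =
      FreeAlgebra.lift K (fun e : Idx r × Idx r => X.1 e.1 e.2) (detPoly K γ r) := by
  rw [Matrix.det_apply, detPoly, map_sum]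
  have h : ∀ s : Finset (Equiv.Perm (Idx r)), ∀ F : Equiv.Perm (Idx r) → Boson 𝒜,
      (∑ π ∈ s, F π).1 1 = ∑ π ∈ s, (F π).1 1 := by
    intro s F
    simp
  rw [h]
  refine Finset.sum_congr rfl fun π _ => ?_
  have hprod : (∏ i, toBoson X (π i) i).1 1 =
      FreeAlgebra.lift K (fun e : Idx r × Idx r => X.1 e.1 e.2)
        (detWord K γ r π Finset.univ.toList) := by
    rw [← prod_toBoson_apply_one, Finset.prod_map_toList]
  rcases Int.units_eq_one_or (Equiv.Perm.sign π) with hs | hs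
  · simpa [hs] using hprod
  · rw [hs, Units.neg_smul, one_smul, Units.neg_smul, one_smul, map_neg, ← hprod]
    rfl

theorem lift_detPoly_mem (X : M0 𝒜 γ r) :
    FreeAlgebra.lift K (fun e : Idx r × Idx r => X.1 e.1 e.2) (detPoly K γ r) ∈ 𝒜 0 := by
  rw [detPoly, map_sum]
  refine Submodule.sum_mem _ fun π _ => ?_
  have h := lift_detWord_mem X π Finset.univ.toList
  rw [wordDegree_univ] at h
  rcases Int.units_eq_one_or (Equiv.Perm.sign π) with hs | hs
  · simpa [hs] using h
  · simpa [hs, Units.neg_smul] using h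

theorem toBoson_apply_eq_zero {X : M0 𝒜 γ r} {i j : Idx r} (h : X.1 i j = 0) :
    toBoson X i j = 0 := by
  apply Subtype.ext
  rw [coe_toBoson, h, map_zero, smul_zero]
  rfl

theorem toBoson_congr {X Y : M0 𝒜 γ r} {i j : Idx r} (h : X.1 i j = Y.1 i j) :
    toBoson X i j = toBoson Y i j := by
  apply Subtype.ext
  rw [coe_toBoson, coe_toBoson, h]

variable [GradedCommutative 𝒜]

/-- The graded determinant: the determinant of `toBoson X` over the commutative ring `Boson 𝒜`,
brought back to `A` by evaluating the operator at `1`. -/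
def gradedDet (X : M0 𝒜 γ r) : 𝒜 0 :=
  ⟨(toBoson X).det.1 1, by rw [det_toBoson_apply_one]; exact lift_detPoly_mem X⟩

theorem isGivenBy_gradedDet : IsGivenBy (detPoly K γ r) (gradedDet (𝒜 := 𝒜) (γ := γ) (r := r)) :=
  det_toBoson_apply_one

/-- An operator in `Boson 𝒜` is determined on the degree-zero part by its value at `1`, as it
commutes with multiplication by degree-zero elements. -/
theorem boson_apply_degree_zero (φ : Boson 𝒜) (a : 𝒜 0) : φ.1 (a : A) = a * φ.1 1 := by
  have h : (φ * zeroToBoson a).1 1 = (zeroToBoson a * φ).1 1 := by rw [mul_comm]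
  have h1 : (φ * zeroToBoson a).1 1 = φ.1 ((zeroToBoson a).1 1) := rfl
  have h2 : (zeroToBoson a * φ).1 1 = (zeroToBoson a).1 (φ.1 1) := rfl
  rwa [h1, h2, zeroToBoson_apply, zeroToBoson_apply, mul_one] at h

theorem gradedDet_mul (X Y : M0 𝒜 γ r) : gradedDet (X * Y) = gradedDet X * gradedDet Y := by
  apply Subtype.ext
  have h : (toBoson (X * Y)).det.1 1 = (toBoson X).det.1 ((gradedDet Y : 𝒜 0) : A) := by
    rw [toBoson_mul, Matrix.det_mul]
    rfl
  change (toBoson (X * Y)).det.1 1 = ((gradedDet X : 𝒜 0) : A) * ((gradedDet Y : 𝒜 0) : A)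
  rw [h, boson_apply_degree_zero, mul_comm_degree_zero]
  rfl

theorem gradedDet_eq_of_det_toBoson {X : M0 𝒜 γ r} {a : 𝒜 0}
    (h : (toBoson X).det = zeroToBoson a) : gradedDet X = a := by
  apply Subtype.ext
  change (toBoson X).det.1 1 = a
  rw [h, zeroToBoson_apply, mul_one]

theorem det_toSquareBlock_toBoson (X : M0 𝒜 γ r) (k : Fin q) :
    ((toBoson X).toSquareBlock Sigma.fst k).det = zeroToBoson (diagBlock X k).det := by
  have h : ((toBoson X).toSquareBlock Sigma.fst k).submatrix (Equiv.sigmaSubtype k).symm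
      (Equiv.sigmaSubtype k).symm = zeroToBoson.mapMatrix (diagBlock X k) := by
    ext a b : 1
    exact toBoson_same_block X k a b
  rw [← Matrix.det_submatrix_equiv_self (Equiv.sigmaSubtype k).symm, h, RingHom.map_det]

theorem gradedDet_of_blockTriangular {X : M0 𝒜 γ r}
    (hX : ∀ i j : Idx r, j.1 < i.1 → X.1 i j = 0) :
    gradedDet X = ∏ k, (diagBlock X k).det := by
  apply gradedDet_eq_of_det_toBoson
  have h : (toBoson X).BlockTriangular Sigma.fst := fun i j hij =>
    toBoson_apply_eq_zero (hX i j hij)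
  rw [h.det_fintype, map_prod]
  exact Finset.prod_congr rfl fun k _ => det_toSquareBlock_toBoson X k

theorem gradedDet_of_blockTriangular_lower {X : M0 𝒜 γ r}
    (hX : ∀ i j : Idx r, i.1 < j.1 → X.1 i j = 0) :
    gradedDet X = ∏ k, (diagBlock X k).det := by
  apply gradedDet_eq_of_det_toBoson
  have h : (toBoson X)ᵀ.BlockTriangular Sigma.fst := fun i j hij =>
    toBoson_apply_eq_zero (hX j i hij)
  rw [← Matrix.det_transpose, h.det_fintype, map_prod]
  refine Finset.prod_congr rfl fun k _ => ?_
  rw [← det_toSquareBlock_toBoson, ← Matrix.det_transpose]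
  rfl

theorem isGradedDet_gradedDet : IsGradedDet (gradedDet (𝒜 := 𝒜) (γ := γ) (r := r)) where
  map_mul := gradedDet_mul
  blockDiagonal _ h := gradedDet_of_blockTriangular fun i j hij => h i j hij.ne'
  unitriangular X h := by
    rcases h with h | h
    · rw [gradedDet_of_blockTriangular h.2]
      simp [h.1]
    · rw [gradedDet_of_blockTriangular_lower h.2]
      simp [h.1]

theorem toBoson_linear {X Y Z : M0 𝒜 γ r} {i j : Idx r} {a b : 𝒜 0}
    (h : Z.1 i j = (a : A) * X.1 i j + (b : A) * Y.1 i j) :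
    toBoson Z i j = zeroToBoson a * toBoson X i j + zeroToBoson b * toBoson Y i j := by
  have hz : ∀ (a : 𝒜 0) (x : A) (g : Deg n),
      twistMul 𝒜 g ((a : A) * x) = (zeroToBoson a).1 * twistMul 𝒜 g x := by
    intro a x g
    ext c
    rw [Module.End.mul_apply, zeroToBoson_apply]
    simp [twistMul]
  apply Subtype.ext
  change _ = (zeroToBoson a).1 * (toBoson X i j).1 + (zeroToBoson b).1 * (toBoson Y i j).1
  simp only [coe_toBoson, h, map_add, hz, mul_smul_comm, smul_add]

theorem gradedDet_linear {X Y Z : M0 𝒜 γ r} {a b : 𝒜 0}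
    (h : (toBoson Z).det = zeroToBoson a * (toBoson X).det + zeroToBoson b * (toBoson Y).det) :
    gradedDet Z = a * gradedDet X + b * gradedDet Y := by
  apply Subtype.ext
  change (toBoson Z).det.1 1 = a * (toBoson X).det.1 1 + b * (toBoson Y).det.1 1
  rw [h, ← zeroToBoson_apply, ← zeroToBoson_apply]
  rfl

theorem linearInRows_gradedDet : LinearInRows (gradedDet (𝒜 := 𝒜) (γ := γ) (r := r)) := by
  intro i a b X Y Z hZ hi
  apply gradedDet_linear
  have hX : toBoson X = (toBoson Z).updateRow i (toBoson X i) := by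
    ext k j : 1
    by_cases hk : k = i
    · subst hk; simp
    · rw [Matrix.updateRow_ne hk, toBoson_congr (hZ k hk j).1]
  have hY : toBoson Y = (toBoson Z).updateRow i (toBoson Y i) := by
    ext k j : 1
    by_cases hk : k = i
    · subst hk; simp
    · rw [Matrix.updateRow_ne hk, toBoson_congr (hZ k hk j).2]
  have hrow : toBoson Z = (toBoson Z).updateRow i
      (zeroToBoson a • toBoson X i + zeroToBoson b • toBoson Y i) := by
    ext k j : 1
    by_cases hk : k = i
    · subst hk
      simpa using toBoson_linear (hi j)
    · rw [Matrix.updateRow_ne hk]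
  rw [hrow, Matrix.det_updateRow_add, Matrix.det_updateRow_smul, Matrix.det_updateRow_smul,
    ← hX, ← hY]

theorem linearInColumns_gradedDet : LinearInColumns (gradedDet (𝒜 := 𝒜) (γ := γ) (r := r)) := by
  intro j a b X Y Z hZ hj
  apply gradedDet_linear
  have hX : toBoson X = (toBoson Z).updateCol j fun i => toBoson X i j := by
    ext i k : 1
    by_cases hk : k = j
    · subst hk; simp
    · rw [Matrix.updateCol_ne hk, toBoson_congr (hZ k hk i).1]
  have hY : toBoson Y = (toBoson Z).updateCol j fun i => toBoson Y i j := by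
    ext i k : 1
    by_cases hk : k = j
    · subst hk; simp
    · rw [Matrix.updateCol_ne hk, toBoson_congr (hZ k hk i).2]
  have hcol : toBoson Z = (toBoson Z).updateCol j
      ((zeroToBoson a • fun i => toBoson X i j) + zeroToBoson b • fun i => toBoson Y i j) := by
    ext i k : 1
    by_cases hk : k = j
    · subst hk
      simpa using toBoson_linear (hj i)
    · rw [Matrix.updateCol_ne hk]
  rw [hcol, Matrix.det_updateCol_add, Matrix.det_updateCol_smul, Matrix.det_updateCol_smul,
    ← hX, ← hY]

end Existence

/-! ### Elementary matrices and an elimination step -/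

section Elimination

variable {K A : Type*} [Field K] [Ring A] [Algebra K A] {n : ℕ}
variable {𝒜 : Deg n → Submodule K A} [GradedAlgebra 𝒜]
variable {q : ℕ} {γ : Fin q ≃ EvenDeg n} {r : Fin q → ℕ}

/-- The diagonal matrix with the given degree-zero entries. -/
def diagonalMatrix (γ : Fin q ≃ EvenDeg n) (r : Fin q → ℕ) (a : Idx r → 𝒜 0) : M0 𝒜 γ r :=
  ⟨Matrix.diagonal fun i => (a i : A), fun i j => by
    by_cases hij : i = j
    · subst hij
      rw [Matrix.diagonal_apply_eq, neg_add_cancel]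
      exact (a i).2
    · rw [Matrix.diagonal_apply_ne _ hij]
      exact Submodule.zero_mem _⟩

theorem coe_diagonalMatrix (a : Idx r → 𝒜 0) :
    (diagonalMatrix γ r a).1 = Matrix.diagonal fun i => (a i : A) := rfl

/-- The identity matrix with the vector `v` added to its column `s`. -/
def colAdd (s : Idx r) (v : ∀ i : Idx r, 𝒜 (entryDegree γ r i s)) : M0 𝒜 γ r :=
  ⟨fun i j => (1 : Matrix (Idx r) (Idx r) A) i j + if j = s then (v i : A) else 0, fun i j => by
    refine Submodule.add_mem _ ((1 : M0 𝒜 γ r).2 i j) ?_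
    split_ifs with h
    · subst h
      exact (v i).2
    · exact Submodule.zero_mem _⟩

/-- The identity matrix with the vector `w` added to its row `s`. -/
def rowAdd (s : Idx r) (w : ∀ j : Idx r, 𝒜 (entryDegree γ r s j)) : M0 𝒜 γ r :=
  ⟨fun i j => (1 : Matrix (Idx r) (Idx r) A) i j + if i = s then (w j : A) else 0, fun i j => by
    refine Submodule.add_mem _ ((1 : M0 𝒜 γ r).2 i j) ?_
    split_ifs with h
    · subst h
      exact (w j).2
    · exact Submodule.zero_mem _⟩

theorem colAdd_mul_apply (s : Idx r) (v : ∀ i : Idx r, 𝒜 (entryDegree γ r i s)) (X : M0 𝒜 γ r)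
    (i j : Idx r) : (colAdd s v * X).1 i j = X.1 i j + (v i : A) * X.1 s j := by
  have h : ∀ k, (colAdd s v).1 i k =
      (1 : Matrix (Idx r) (Idx r) A) i k + if k = s then (v i : A) else 0 := fun _ => rfl
  simp [Matrix.mul_apply, h, add_mul, Finset.sum_add_distrib, Matrix.one_apply]

theorem mul_rowAdd_apply (s : Idx r) (w : ∀ j : Idx r, 𝒜 (entryDegree γ r s j)) (X : M0 𝒜 γ r)
    (i j : Idx r) : (X * rowAdd s w).1 i j = X.1 i j + X.1 i s * (w j : A) := by
  have h : ∀ k, (rowAdd s w).1 k j =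
      (1 : Matrix (Idx r) (Idx r) A) k j + if k = s then (w j : A) else 0 := fun _ => rfl
  simp [Matrix.mul_apply, h, mul_add, Finset.sum_add_distrib, Matrix.one_apply]

/-- The identity matrix together with those off-diagonal entries of `X` whose position lies in `T`.
-/
def offDiagPart (X : M0 𝒜 γ r) (T : Finset (Idx r × Idx r)) : M0 𝒜 γ r :=
  ⟨fun i j => (1 : Matrix (Idx r) (Idx r) A) i j + if i ≠ j ∧ (i, j) ∈ T then X.1 i j else 0,
    fun i j => by
      refine Submodule.add_mem _ ((1 : M0 𝒜 γ r).2 i j) ?_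
      split_ifs
      · exact X.2 i j
      · exact Submodule.zero_mem _⟩

theorem offDiagPart_apply (X : M0 𝒜 γ r) (T : Finset (Idx r × Idx r)) (i j : Idx r) :
    (offDiagPart X T).1 i j =
      (1 : Matrix (Idx r) (Idx r) A) i j + if i ≠ j ∧ (i, j) ∈ T then X.1 i j else 0 := rfl

theorem offDiagPart_insert (X : M0 𝒜 γ r)
    (hX : ∀ i j k, i ≠ j → j ≠ k → X.1 i j * X.1 j k = 0) {e : Idx r × Idx r}
    {T : Finset (Idx r × Idx r)} (he : e ∉ T) :
    offDiagPart X (insert e T) = offDiagPart X {e} * offDiagPart X T := by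
  obtain ⟨a, b⟩ := e
  ext i j
  rw [MulMemClass.coe_mul, Matrix.mul_apply]
  simp only [offDiagPart_apply, add_mul, Finset.sum_add_distrib, mul_add, Finset.mem_insert,
    Finset.mem_singleton, Prod.mk.injEq]
  have h0 : ∀ k, (if i ≠ k ∧ i = a ∧ k = b then X.1 i k else 0) *
      (if k ≠ j ∧ (k, j) ∈ T then X.1 k j else 0) = 0 := by
    intro k
    split_ifs with h1 h2
    · exact hX i k j h1.1 h2.1
    all_goals simp
  have h1 : ∀ g : Idx r → A, ∑ k, (1 : Matrix (Idx r) (Idx r) A) i k * g k = g i := by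
    simp [Matrix.one_apply]
  have h2 : ∀ g : Idx r → A, ∑ k, g k * (1 : Matrix (Idx r) (Idx r) A) k j = g j := by
    simp [Matrix.one_apply]
  simp only [h0, h1, h2 fun k => if i ≠ k ∧ i = a ∧ k = b then X.1 i k else 0,
    Finset.sum_const_zero, add_zero]
  by_cases h : i = a ∧ j = b
  · obtain ⟨rfl, rfl⟩ := h
    simp [he]
  · simp [h, add_comm]

variable [GradedCommutative 𝒜]

namespace IsGradedDet

variable {f : M0 𝒜 γ r → 𝒜 0}

theorem map_diagonalMatrix (hf : IsGradedDet f) (a : Idx r → 𝒜 0) :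
    f (diagonalMatrix γ r a) = ∏ i, a i := by
  rw [hf.blockDiagonal, Fintype.prod_sigma]
  · refine Finset.prod_congr rfl fun k _ => ?_
    have h : diagBlock (diagonalMatrix γ r a) k = Matrix.diagonal fun b => a ⟨k, b⟩ := by
      ext b c
      by_cases hbc : b = c
      · subst hbc
        simp [diagBlock, diagonalMatrix]
      · simp [diagBlock, diagonalMatrix, hbc]
    rw [h, Matrix.det_diagonal]
  · intro i j hij
    exact Matrix.diagonal_apply_ne _ fun h => hij (congrArg Sigma.fst h)

/-- A transvection within a block is block diagonal with determinant one, and otherwise it is block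
unitriangular. -/
theorem map_eq_one_of_transvection (hf : IsGradedDet f) {i s : Idx r} (his : i ≠ s) (c : A)
    {X : M0 𝒜 γ r}
    (hX : ∀ k j, X.1 k j = (1 : Matrix (Idx r) (Idx r) A) k j + if k = i ∧ j = s then c else 0) :
    f X = 1 := by
  have hoff : ∀ k j : Idx r, k.1 ≠ j.1 → ¬ (k = i ∧ j = s) → X.1 k j = 0 := by
    intro k j hkj h
    rw [hX, if_neg h, add_zero, Matrix.one_apply_ne fun h => hkj (congrArg Sigma.fst h)]
  have hone : ∀ k, (¬ (k = i.1 ∧ k = s.1)) → diagBlock X k = 1 := by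
    intro k hk
    ext a b
    have h0 : ¬ ((⟨k, a⟩ : Idx r) = i ∧ (⟨k, b⟩ : Idx r) = s) := fun h =>
      hk ⟨congrArg Sigma.fst h.1, congrArg Sigma.fst h.2⟩
    change X.1 ⟨k, a⟩ ⟨k, b⟩ = _
    rw [hX, if_neg h0, add_zero]
    by_cases hab : a = b
    · subst hab; simp
    · simp [hab]
  rcases lt_trichotomy i.1 s.1 with h | h | h
  · refine hf.unitriangular X (Or.inl ⟨fun k => hone k fun hk => ?_, fun k j hkj => ?_⟩)
    · exact h.ne (hk.1.symm.trans hk.2)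
    · refine hoff k j hkj.ne' ?_
      rintro ⟨rfl, rfl⟩
      exact h.not_gt hkj
  · rw [hf.blockDiagonal X fun k j hkj => hoff k j hkj ?_]
    · refine Finset.prod_eq_one fun k _ => ?_
      by_cases hk : k = i.1
      · obtain ⟨k', a⟩ := i
        obtain ⟨k'', b⟩ := s
        dsimp only at h hk
        subst h hk
        have hc : c ∈ 𝒜 0 := by
          have h1 := X.2 ⟨k, a⟩ ⟨k, b⟩
          rw [hX, Matrix.one_apply_ne his, neg_add_cancel] at h1
          simpa using h1
        have hab : a ≠ b := fun h => his (by rw [h])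
        have hT : diagBlock X k = Matrix.transvection a b (⟨c, hc⟩ : 𝒜 0) := by
          ext a' b'
          change X.1 ⟨k, a'⟩ ⟨k, b'⟩ = _
          rw [hX, Matrix.transvection, Matrix.add_apply, Matrix.single_apply]
          by_cases hab' : a' = b'
          · subst hab'
            by_cases h2 : a = a' ∧ b = a'
            · exact absurd (h2.1.trans h2.2.symm) hab
            · simp [h2, eq_comm]
          · by_cases h2 : a = a' ∧ b = b'
            · obtain ⟨rfl, rfl⟩ := h2
              simp [hab']
            · have h3 : ¬ (a' = a ∧ b' = b) := fun h => h2 ⟨h.1.symm, h.2.symm⟩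
              simp [hab', h2, h3]
        rw [hT, Matrix.det_transvection_of_ne _ _ hab]
      · rw [hone k fun h' => hk h'.1, Matrix.det_one]
    · rintro ⟨rfl, rfl⟩
      exact hkj h
  · refine hf.unitriangular X (Or.inr ⟨fun k => hone k fun hk => ?_, fun k j hkj => ?_⟩)
    · exact h.ne' (hk.1.symm.trans hk.2)
    · refine hoff k j hkj.ne ?_
      rintro ⟨rfl, rfl⟩
      exact h.not_gt hkj

theorem map_one (hf : IsGradedDet f) : f 1 = 1 := by
  refine hf.unitriangular 1 (Or.inl ⟨fun k => ?_, fun i j hij => ?_⟩)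
  · ext a b
    by_cases hab : a = b
    · subst hab; simp [diagBlock]
    · simp [diagBlock, hab]
  · exact Matrix.one_apply_ne fun h => hij.ne (congrArg Sigma.fst h.symm)

/-- Such a matrix is the product, in any order, of the transvections given by its off-diagonal
entries. -/
theorem map_eq_one_of_mul_eq_zero (hf : IsGradedDet f) {X : M0 𝒜 γ r} (hd : ∀ i, X.1 i i = 1)
    (hX : ∀ i j k, i ≠ j → j ≠ k → X.1 i j * X.1 j k = 0) : f X = 1 := by
  have key : ∀ T, f (offDiagPart X T) = 1 := by
    intro T
    induction T using Finset.induction_on with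
    | empty =>
      refine (congrArg f ?_).trans hf.map_one
      ext i j
      simp [offDiagPart_apply]
    | insert e T he ih =>
      rw [offDiagPart_insert X hX he, hf.map_mul, ih, mul_one]
      obtain ⟨a, b⟩ := e
      by_cases hab : a = b
      · refine (congrArg f ?_).trans hf.map_one
        ext i j
        rw [offDiagPart_apply, if_neg]
        · simp
        · rintro ⟨hij, h⟩
          obtain ⟨rfl, rfl⟩ := Prod.mk.inj (Finset.mem_singleton.mp h)
          exact hij hab
      · refine hf.map_eq_one_of_transvection hab (X.1 a b) fun k j => ?_
        rw [offDiagPart_apply]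
        by_cases h : k = a ∧ j = b
        · obtain ⟨rfl, rfl⟩ := h
          simp [hab]
        · simp [h]
  rw [← key Finset.univ]
  congr 1
  ext i j
  by_cases hij : i = j
  · subst hij; simp [offDiagPart_apply, hd]
  · simp [offDiagPart_apply, hij]

theorem map_colAdd (hf : IsGradedDet f) (s : Idx r) (v : ∀ i : Idx r, 𝒜 (entryDegree γ r i s))
    (hv : v s = 0) : f (colAdd s v) = 1 := by
  refine hf.map_eq_one_of_mul_eq_zero (fun i => ?_) fun i j k hij hjk => ?_
  · by_cases hi : i = s
    · subst hi; simp [colAdd, hv]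
    · simp [colAdd, hi]
  · by_cases hj : j = s
    · subst hj
      by_cases hk : k = j
      · exact absurd hk.symm hjk
      · simp [colAdd, hk, hjk]
    · simp [colAdd, hj, hij]

theorem map_rowAdd (hf : IsGradedDet f) (s : Idx r) (w : ∀ j : Idx r, 𝒜 (entryDegree γ r s j))
    (hw : w s = 0) : f (rowAdd s w) = 1 := by
  refine hf.map_eq_one_of_mul_eq_zero (fun i => ?_) fun i j k hij hjk => ?_
  · by_cases hi : i = s
    · subst hi; simp [rowAdd, hw]
    · simp [rowAdd, hi]
  · by_cases hj : j = s
    · subst hj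
      simp [rowAdd, hij]
    · simp [rowAdd, hj, hjk]

end IsGradedDet

/-- One division-free elimination step with pivot `x = X s s`: clear the rest of row and column `s`
and scale by `x`, so that `X` becomes `x² X - x (column s) (row s)`, with `x³` placed at `(s, s)`.
-/
def elim {ι R : Type*} [DecidableEq ι] [Ring R] (s : ι) (X : Matrix ι ι R) : Matrix ι ι R :=
  fun i j => X s s * (X s s * X i j - X i s * X s j) + if i = s ∧ j = s then X s s ^ 3 else 0

/-- The diagonal entry `X s s`, as an element of the degree-zero part. -/
def pivot (X : M0 𝒜 γ r) (s : Idx r) : 𝒜 0 := diagBlock X s.1 s.2 s.2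

omit [GradedCommutative 𝒜] in
theorem coe_pivot (X : M0 𝒜 γ r) (s : Idx r) : (pivot X s : A) = X.1 s s := rfl

/-- The elimination step multiplies `X` from both sides by diagonal matrices and by products of
transvections, so it changes every `f` that satisfies the three conditions by the same known factor.
-/
theorem exists_elim (X : M0 𝒜 γ r) (s : Idx r) :
    ∃ Y : M0 𝒜 γ r, Y.1 = elim s X.1 ∧ ∀ f : M0 𝒜 γ r → 𝒜 0, IsGradedDet f →
      f Y = pivot X s ^ (2 * Fintype.card (Idx r)) * f X := by
  set x := pivot X s with hx
  have hxX : X.1 s s = (x : A) := rfl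
  let v : ∀ i : Idx r, 𝒜 (entryDegree γ r i s) := fun i => if i = s then 0 else -⟨X.1 i s, X.2 i s⟩
  let w : ∀ j : Idx r, 𝒜 (entryDegree γ r s j) := fun j => if j = s then 0 else -⟨X.1 s j, X.2 s j⟩
  -- The factors `y` on both sides make column and row `s` left and right multiples of the pivot away
  -- from `(s, s)`; with the factor `z`, each index, `s` included, contributes `x²` to the scaling.
  let y : Idx r → 𝒜 0 := fun i => if i = s then 1 else x
  let z : Idx r → 𝒜 0 := fun i => if i = s then x ^ 2 else 1
  have hv : v s = 0 := if_pos rfl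
  have hw : w s = 0 := if_pos rfl
  refine ⟨colAdd s v * (diagonalMatrix γ r y * X * diagonalMatrix γ r y) * rowAdd s w *
    diagonalMatrix γ r z, ?_, fun f hf => ?_⟩
  · have hcomm : ∀ b : A, (x : A) * b = b * x := mul_comm_degree_zero 𝒜 x
    ext i j
    rw [MulMemClass.coe_mul, coe_diagonalMatrix, Matrix.mul_diagonal, mul_rowAdd_apply,
      colAdd_mul_apply, colAdd_mul_apply]
    have hM : ∀ i j, (diagonalMatrix γ r y * X * diagonalMatrix γ r y).1 i j =
        y i * X.1 i j * y j := by
      intro i j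
      rw [MulMemClass.coe_mul, MulMemClass.coe_mul, coe_diagonalMatrix, Matrix.mul_diagonal,
        Matrix.diagonal_mul]
    simp only [hM, elim, v, w, y, z, hxX]
    by_cases hi : i = s <;> by_cases hj : j = s
    · subst hi hj
      simp [hxX, pow_succ, mul_assoc]
    · subst hi
      simp [hj, hxX, hcomm]
    · subst hj
      simp [hi, hxX, hcomm]
    · have h1 : X.1 i s * (X.1 s j * x) = x * (X.1 i s * X.1 s j) := by rw [← mul_assoc, hcomm]
      have h2 : x * X.1 i j * x = x * (x * X.1 i j) := (hcomm _).symm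
      have h3 : ((1 : 𝒜 0) : A) = 1 := rfl
      simp only [hi, hj, if_false, false_and, if_true, NegMemClass.coe_neg, h3, mul_one, one_mul,
        neg_mul, h1, h2, hcomm (X.1 i s), add_neg_cancel, zero_mul, add_zero]
      rw [mul_sub, sub_eq_add_neg]
  · rw [hf.map_mul, hf.map_mul, hf.map_mul, hf.map_mul, hf.map_mul, hf.map_colAdd s v hv,
      hf.map_rowAdd s w hw, hf.map_diagonalMatrix, hf.map_diagonalMatrix]
    have h : (∏ i, y i) * (∏ i, y i) * ∏ i, z i = x ^ (2 * Fintype.card (Idx r)) := by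
      rw [← Finset.prod_mul_distrib, ← Finset.prod_mul_distrib, pow_mul, ← Finset.card_univ,
        ← Finset.prod_const]
      refine Finset.prod_congr rfl fun i _ => ?_
      by_cases hi : i = s <;> simp [y, z, hi, sq]
    rw [← h]
    ring

end Elimination

/-! ### Iterated elimination -/

section RawElimination

variable {ι R S : Type*} [DecidableEq ι] [Fintype ι] [Ring R] [Ring S]

omit [Fintype ι] in
theorem map_elim (φ : R →+* S) (s : ι) (X : Matrix ι ι R) :
    (elim s X).map φ = elim s (X.map φ) := by
  ext i j
  by_cases h : i = s ∧ j = s <;> simp [elim, h]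

omit [Fintype ι] in
theorem elim_one (s : ι) : elim s (1 : Matrix ι ι R) = 1 := by
  ext i j
  by_cases hi : i = s
  · subst hi
    by_cases hj : j = i
    · subst hj; simp [elim]
    · have hj' : i ≠ j := fun h => hj h.symm
      simp [elim, hj, Matrix.one_apply_ne hj']
  · simp [elim, hi, Matrix.one_apply_ne hi]

/-- The product of the powers of the pivots met when eliminating successively at the indices in `l`.
-/
def pivotProd : List ι → Matrix ι ι R → R
  | [], _ => 1
  | s :: l, X => X s s ^ (2 * Fintype.card ι) * pivotProd l (elim s X)

theorem map_pivotProd (φ : R →+* S) (l : List ι) (X : Matrix ι ι R) :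
    φ (pivotProd l X) = pivotProd l (X.map φ) := by
  induction l generalizing X with
  | nil => simp [pivotProd]
  | cons s l ih => simp [pivotProd, ih, map_elim]

theorem pivotProd_one (l : List ι) : pivotProd l (1 : Matrix ι ι R) = 1 := by
  induction l with
  | nil => rfl
  | cons s l ih => simp [pivotProd, elim_one, ih]

end RawElimination

section Annihilation

variable {K A : Type*} [Field K] [Ring A] [Algebra K A] {n : ℕ}
variable {𝒜 : Deg n → Submodule K A} [GradedAlgebra 𝒜] [GradedCommutative 𝒜]
variable {q : ℕ} {γ : Fin q ≃ EvenDeg n} {r : Fin q → ℕ}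

/-- Row and column `i` of `X` vanish off the diagonal. -/
def Isolated {ι R : Type*} [Zero R] (X : Matrix ι ι R) (i : ι) : Prop :=
  ∀ j, j ≠ i → X i j = 0 ∧ X j i = 0

theorem Isolated.elim {ι R : Type*} [DecidableEq ι] [Ring R] {X : Matrix ι ι R} {i s : ι}
    (h : Isolated X i) (his : i ≠ s) : Isolated (elim s X) i := by
  intro j hj
  simp [GradedDet.elim, his, h j hj, (h s his.symm)]

theorem isolated_elim_self {ι R : Type*} [DecidableEq ι] [Ring R] {X : Matrix ι ι R} {s : ι}
    (hs : ∀ b, X s s * b = b * X s s) : Isolated (elim s X) s := by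
  intro j hj
  simp [GradedDet.elim, hj, hs]

variable {f g : M0 𝒜 γ r → 𝒜 0}

theorem IsGradedDet.eq_of_isolated (hf : IsGradedDet f) (hg : IsGradedDet g) {X : M0 𝒜 γ r}
    (hX : ∀ i, Isolated X.1 i) : f X = g X := by
  have h : X = diagonalMatrix γ r (pivot X) := by
    ext i j
    rw [coe_diagonalMatrix]
    by_cases hij : i = j
    · subst hij
      rw [Matrix.diagonal_apply_eq, coe_pivot]
    · rw [Matrix.diagonal_apply_ne _ hij, (hX j i hij).2]
  rw [h, hf.map_diagonalMatrix, hg.map_diagonalMatrix]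

theorem pivot_comm (X : M0 𝒜 γ r) (s : Idx r) (b : A) : X.1 s s * b = b * X.1 s s :=
  mul_comm_degree_zero 𝒜 (pivot X s) b

/-- Elimination at all indices of `l` leads to a diagonal matrix, where `f` and `g` agree. -/
theorem IsGradedDet.pivotProd_mul_sub (hf : IsGradedDet f) (hg : IsGradedDet g) (l : List (Idx r))
    (X : M0 𝒜 γ r) (hX : ∀ i ∉ l, Isolated X.1 i) :
    pivotProd l X.1 * ((f X : A) - (g X : A)) = 0 := by
  induction l generalizing X with
  | nil =>
    rw [hf.eq_of_isolated hg fun i => hX i (List.not_mem_nil), sub_self, mul_zero]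
  | cons s l ih =>
    obtain ⟨Y, hY, hYf⟩ := exists_elim X s
    have h := ih Y fun i hi => by
      rw [hY]
      by_cases his : i = s
      · subst his
        exact isolated_elim_self (pivot_comm X i)
      · exact (hX i (by simp [his, hi])).elim his
    rw [hYf f hf, hYf g hg, hY] at h
    have hx : ∀ b : A, ((pivot X s ^ (2 * Fintype.card (Idx r)) : 𝒜 0) : A) * b =
        b * ((pivot X s ^ (2 * Fintype.card (Idx r)) : 𝒜 0) : A) := mul_comm_degree_zero 𝒜 _
    have hp : X.1 s s ^ (2 * Fintype.card (Idx r)) =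
        ((pivot X s ^ (2 * Fintype.card (Idx r)) : 𝒜 0) : A) := rfl
    rw [pivotProd, hp, hx, mul_assoc, mul_sub]
    exact h

end Annihilation

/-! ### Polynomials over a noncommutative algebra at central points -/

section Lines

variable {K A : Type*} [Field K] [Ring A] [Algebra K A]

/-- Evaluation of a polynomial over `A` at a scalar `t`; it is multiplicative because `t` is
central. -/
noncomputable def evalAt (A : Type*) [Ring A] [Algebra K A] (t : K) : Polynomial A →ₐ[K] A :=
  Polynomial.eval₂AlgHom (AlgHom.id K A) (algebraMap K A t)
    fun a => (Algebra.commutes t a).symm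

theorem evalAt_apply (t : K) (F : Polynomial A) :
    evalAt A t F = F.sum fun m a => a * algebraMap K A t ^ m := by
  exact Polynomial.eval₂_eq_sum

@[simp] theorem evalAt_C (t : K) (a : A) : evalAt A t (Polynomial.C a) = a := Polynomial.eval₂_C _ _

@[simp] theorem evalAt_X (t : K) : evalAt A t Polynomial.X = algebraMap K A t := Polynomial.eval₂_X _ _

/-- Linear functionals `A → K` reduce this to polynomials over the infinite field `K`. -/
theorem eq_zero_of_forall_evalAt_eq_zero [Infinite K] {F : Polynomial A}
    (h : ∀ t : K, evalAt A t F = 0) : F = 0 := by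
  ext m
  rw [Polynomial.coeff_zero, ← Module.forall_dual_apply_eq_zero_iff K]
  intro φ
  let G : Polynomial K := ∑ k ∈ F.support, Polynomial.monomial k (φ (F.coeff k))
  have hG : G = 0 := by
    apply Polynomial.funext
    intro t
    have h1 := congrArg φ (h t)
    rw [evalAt_apply, Polynomial.sum, map_sum, map_zero] at h1
    rw [Polynomial.eval_zero, ← h1, Polynomial.eval_finsetSum]
    refine Finset.sum_congr rfl fun k _ => ?_
    rw [Polynomial.eval_monomial, ← map_pow, ← Algebra.commutes, ← Algebra.smul_def, map_smul,
      smul_eq_mul, mul_comm]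
  have h2 := congrArg (fun P => Polynomial.coeff P m) hG
  simp only [G, Polynomial.finsetSum_coeff, Polynomial.coeff_monomial, Finset.sum_ite_eq',
    Polynomial.coeff_zero] at h2
  by_cases hm : m ∈ F.support
  · simpa [hm] using h2
  · rw [Polynomial.notMem_support_iff.mp hm, map_zero]

theorem eq_zero_of_mul_eq_zero_of_coeff_zero_eq_one {P F : Polynomial A} (hP : P.coeff 0 = 1)
    (h : P * F = 0) : F = 0 := by
  ext m
  induction m using Nat.strong_induction_on with
  | _ m ih =>
    have h1 := congrArg (fun P => Polynomial.coeff P m) h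
    simp only [Polynomial.coeff_mul, Polynomial.coeff_zero] at h1
    rw [Finset.sum_eq_single (0, m)] at h1
    · simpa [hP] using h1
    · rintro ⟨a, b⟩ hab hne
      have hab' := Finset.HasAntidiagonal.mem_antidiagonal.mp hab
      have hb : b < m := by
        by_contra hb
        exact hne (by ext <;> simp at * <;> omega)
      simp [ih b hb]
    · simp

end Lines

/-! ### Uniqueness among maps that are polynomial on lines -/

section LinesInM0

variable {K A : Type*} [Field K] [Ring A] [Algebra K A] {n : ℕ}
variable {𝒜 : Deg n → Submodule K A} [GradedAlgebra 𝒜]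
variable {q : ℕ} {γ : Fin q ≃ EvenDeg n} {r : Fin q → ℕ} {f g : M0 𝒜 γ r → 𝒜 0}

/-- The point `(1 - t) 1 + t X` of the line through the identity and `X`. -/
def line (X : M0 𝒜 γ r) (t : K) : M0 𝒜 γ r := (1 - t) • (1 : M0 𝒜 γ r) + t • X

/-- The restriction of `f` to every line through the identity is polynomial in the parameter, with
coefficients in `A`. -/
def PolynomialOnLines (f : M0 𝒜 γ r → 𝒜 0) : Prop :=
  ∀ X, ∃ F : Polynomial A, ∀ t : K, (f (line X t) : A) = evalAt A t F

/-- The line through the identity and `X`, as a matrix over the polynomials in its parameter. -/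
noncomputable def polyLine (X : M0 𝒜 γ r) : Matrix (Idx r) (Idx r) (Polynomial A) := fun i j =>
  (1 - Polynomial.X) * Polynomial.C ((1 : Matrix (Idx r) (Idx r) A) i j) +
    Polynomial.X * Polynomial.C (X.1 i j)

theorem evalAt_polyLine (X : M0 𝒜 γ r) (t : K) (i j : Idx r) :
    evalAt A t (polyLine X i j) = (line X t).1 i j := by
  have h : (line X t).1 i j = (1 - t) • (1 : Matrix (Idx r) (Idx r) A) i j + t • X.1 i j := rfl
  simp [polyLine, h, Algebra.smul_def, Algebra.commutes]

theorem polyLine_coeff_zero (X : M0 𝒜 γ r) :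
    (polyLine X).map (Polynomial.constantCoeff (R := A)) = 1 := by
  ext i j
  simp [polyLine, Matrix.map_apply]

theorem IsGivenBy.polynomialOnLines {p : FreeAlgebra K (Idx r × Idx r)} (hf : IsGivenBy p f) :
    PolynomialOnLines f := by
  intro X
  refine ⟨FreeAlgebra.lift K (fun e : Idx r × Idx r => polyLine X e.1 e.2) p, fun t => ?_⟩
  rw [hf, ← AlgHom.comp_apply]
  congr 1
  apply FreeAlgebra.hom_ext
  funext e
  simp [evalAt_polyLine]

variable [GradedCommutative 𝒜]

/-- On the line through the identity and `X` the product of pivots is a polynomial with constant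
coefficient `1`, which can be cancelled; the point `t = 1` of the line is `X`. -/
theorem IsGradedDet.eq_of_polynomialOnLines [Infinite K] (hf : IsGradedDet f) (hg : IsGradedDet g)
    (hfp : PolynomialOnLines f) (hgp : PolynomialOnLines g) : f = g := by
  funext X
  obtain ⟨F, hF⟩ := hfp X
  obtain ⟨G, hG⟩ := hgp X
  have h0 : pivotProd Finset.univ.toList (polyLine X) * (F - G) = 0 := by
    apply eq_zero_of_forall_evalAt_eq_zero (K := K)
    intro t
    have hmap : (polyLine X).map (evalAt A t : Polynomial A →+* A) = (line X t).1 := by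
      ext i j
      exact evalAt_polyLine X t i j
    have hpp := map_pivotProd (evalAt A t : Polynomial A →+* A) Finset.univ.toList (polyLine X)
    rw [hmap] at hpp
    rw [_root_.map_mul, map_sub, ← hF, ← hG]
    refine (congrArg (· * _) hpp).trans ?_
    exact hf.pivotProd_mul_sub hg _ _ fun i hi => absurd (by simp) hi
  have h1 : F - G = 0 := by
    refine eq_zero_of_mul_eq_zero_of_coeff_zero_eq_one ?_ h0
    have h := map_pivotProd (Polynomial.constantCoeff (R := A)) Finset.univ.toList (polyLine X)
    rwa [polyLine_coeff_zero, pivotProd_one] at h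
  have h2 : line X (1 : K) = X := by simp [line]
  apply Subtype.ext
  rw [← h2, hF, hG, sub_eq_zero.mp h1]

end LinesInM0

/-! ### Uniqueness over a reduced degree-zero part -/

/-- The entries generate a nilpotent ideal, and its powers contain the entries of the powers of `M`.
-/
theorem exists_pow_succ_eq_zero_of_entries_nilpotent {ι B : Type*} [Fintype ι] [DecidableEq ι]
    [CommRing B] {M : Matrix ι ι B} (hM : ∀ i j, IsNilpotent (M i j)) :
    ∃ k : ℕ, M ^ (k + 1) = 0 := by
  let I : Ideal B := Ideal.span (Set.range fun e : ι × ι => M e.1 e.2)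
  have hfg : I.FG := Submodule.fg_span (Set.finite_range _)
  have hI : IsNilpotent I := hfg.isNilpotent_iff_le_nilradical.mpr <| Ideal.span_le.mpr <| by
    rintro _ ⟨e, rfl⟩
    exact hM e.1 e.2
  obtain ⟨k, hk⟩ := hI
  have hmem : ∀ i j, M i j ∈ I := fun i j => Ideal.subset_span ⟨(i, j), rfl⟩
  have hpow : ∀ m i j, (M ^ m) i j ∈ I ^ m := by
    intro m
    induction m with
    | zero => simp
    | succ m ih =>
      intro i j
      rw [pow_succ M, Matrix.mul_apply, pow_succ I]
      exact Submodule.sum_mem _ fun l _ => Ideal.mul_mem_mul (ih i l) (hmem l j)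
  refine ⟨k, ?_⟩
  ext i j
  have h := Ideal.pow_le_pow_right (Nat.le_succ k) (hpow (k + 1) i j)
  rw [hk] at h
  simpa using h

variable {K A : Type*} [Field K] [Ring A] [Algebra K A] {n : ℕ}
variable {𝒜 : Deg n → Submodule K A} [GradedAlgebra 𝒜]
variable {q : ℕ} {γ : Fin q ≃ EvenDeg n} {r : Fin q → ℕ}

section Reduced

variable [GradedCommutative 𝒜] {f g : M0 𝒜 γ r → 𝒜 0}

theorem exists_pow_succ_eq_zero_of_mul_self_eq_zero {W : M0 𝒜 γ r}
    (hW : ∀ i j, W.1 i j * W.1 i j = 0) : ∃ k : ℕ, W ^ (k + 1) = 0 := by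
  have hpow : ∀ k : ℕ, toBoson (W ^ (k + 1)) = toBoson W ^ (k + 1) := by
    intro k
    induction k with
    | zero => simp
    | succ k ih => rw [pow_succ, toBoson_mul, ih, pow_succ _ (k + 1)]
  obtain ⟨k, hk⟩ := exists_pow_succ_eq_zero_of_entries_nilpotent (M := toBoson W) fun i j =>
    ⟨2, Subtype.ext <| by
      rw [sq]
      change (toBoson W i j).1 * (toBoson W i j).1 = 0
      rw [coe_toBoson, smul_mul_smul_comm, twistMul_mul 𝒜 _ _ (W.2 i j), hW, map_zero, smul_zero,
        smul_zero]⟩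
  exact ⟨k, eq_zero_of_toBoson_eq_zero ((hpow k).trans hk)⟩

/-- The condition on `δ` makes the part of `δ X` outside `S` nilpotent, so some power of `δ X` has a
vanishing column and `f` takes the value `0` on it. -/
theorem IsGradedDet.mul_eq_zero_of_isolated (hf : IsGradedDet f) [IsReduced (𝒜 0)]
    {S : Finset (Idx r)} {X : M0 𝒜 γ r} (hX : ∀ i ∈ S, Isolated X.1 i) {s : Idx r} (hs : s ∉ S)
    {δ : 𝒜 0} (hδ : ∀ i ∉ S, ∀ j ∉ S, X.1 i j * X.1 i j * δ = 0) : f X * δ = 0 := by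
  set Z := X * diagonalMatrix γ r fun _ => δ with hZ
  have hZ_apply : ∀ i j, Z.1 i j = X.1 i j * δ := by
    intro i j
    rw [hZ, MulMemClass.coe_mul, coe_diagonalMatrix, Matrix.mul_diagonal]
  set E : M0 𝒜 γ r := diagonalMatrix γ r fun i => if i ∈ S then 0 else 1 with hE
  set E' : M0 𝒜 γ r := diagonalMatrix γ r fun i => if i ∈ S then 1 else 0 with hE'
  have hadd : E' + E = 1 := by
    ext i j
    rw [AddMemClass.coe_add, hE, hE', coe_diagonalMatrix, coe_diagonalMatrix]
    by_cases hij : i = j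
    · subst hij
      by_cases hi : i ∈ S <;> simp [hi]
    · simp [hij]
  have hidem : IsIdempotentElem E := by
    apply Subtype.ext
    rw [MulMemClass.coe_mul, hE, coe_diagonalMatrix, Matrix.diagonal_mul_diagonal]
    congr 1
    funext i
    by_cases hi : i ∈ S <;> simp [hi]
  have hZE : ∀ i j, (Z * E).1 i j = X.1 i j * δ * ((if j ∈ S then 0 else 1 : 𝒜 0) : A) := by
    intro i j
    rw [← hZ_apply]
    exact Matrix.mul_diagonal ..
  have hEZ : ∀ i j, (E * Z).1 i j = ((if i ∈ S then 0 else 1 : 𝒜 0) : A) * (X.1 i j * δ) := by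
    intro i j
    rw [← hZ_apply]
    exact Matrix.diagonal_mul ..
  have hcomm : Commute Z E := by
    apply Subtype.ext
    ext i j
    rw [hZE, hEZ]
    by_cases hij : i = j
    · subst hij
      by_cases hi : i ∈ S <;> simp [hi]
    · by_cases hi : i ∈ S
      · simp [(hX i hi j (Ne.symm hij)).1]
      · by_cases hj : j ∈ S
        · simp [(hX j hj i hij).2]
        · simp [hi, hj]
  obtain ⟨k, hk⟩ := exists_pow_succ_eq_zero_of_mul_self_eq_zero (W := Z * E) fun i j => by
    rw [hZE]
    by_cases hj : j ∈ S
    · simp [hj]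
    · by_cases hi : i ∈ S
      · have hij : j ≠ i := fun h => hj (h ▸ hi)
        simp [(hX i hi j hij).1]
      · have h0 : X.1 i j * δ * (X.1 i j * δ) = 0 := by
          rw [mul_assoc, mul_comm_degree_zero 𝒜 δ, ← mul_assoc, ← mul_assoc, hδ i hi j hj, zero_mul]
        simpa [hj] using h0
  rw [hcomm.mul_pow, hidem.pow_succ_eq] at hk
  have hfE' : f E' = 0 := by
    rw [hE', hf.map_diagonalMatrix]
    exact Finset.prod_eq_zero (Finset.mem_univ s) (by simp [hs])
  have hpow : ∀ m : ℕ, f (Z ^ m) = f Z ^ m := by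
    intro m
    induction m with
    | zero => rw [pow_zero, pow_zero, hf.map_one]
    | succ m ih => rw [pow_succ, hf.map_mul, ih, pow_succ]
  have hfZ : f Z = 0 := by
    have h : Z ^ (k + 1) = Z ^ (k + 1) * E' := by
      conv_lhs => rw [← mul_one (Z ^ (k + 1)), ← hadd, mul_add, hk, add_zero]
    have h2 := congrArg f h
    rw [hf.map_mul, hfE', mul_zero, hpow] at h2
    exact eq_zero_of_pow_eq_zero h2
  rw [hZ, hf.map_mul, hf.map_diagonalMatrix, Finset.prod_const] at hfZ
  -- `f (δ X) = f X * δ^N` with `N` the size of the matrices, nonzero because `s` exists.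
  apply eq_zero_of_pow_eq_zero (n := Finset.card (Finset.univ : Finset (Idx r)))
  have hc : Finset.card (Finset.univ : Finset (Idx r)) ≠ 0 :=
    Finset.card_ne_zero_of_mem (Finset.mem_univ s)
  obtain ⟨c, hc⟩ := Nat.exists_eq_succ_of_ne_zero hc
  rw [hc] at hfZ ⊢
  rw [mul_pow, Nat.succ_eq_add_one, pow_succ (f X), mul_assoc, hfZ, mul_zero]

/-- Adding a left multiple of row `i` to row `s` does not change the values of graded determinants.
-/
theorem exists_add_row (X : M0 𝒜 γ r) {i s : Idx r} (his : i ≠ s) {u : A}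
    (hu : u ∈ 𝒜 (entryDegree γ r s i)) :
    ∃ Y : M0 𝒜 γ r, (∀ k j, Y.1 k j = X.1 k j + if k = s then u * X.1 i j else 0) ∧
      ∀ f : M0 𝒜 γ r → 𝒜 0, IsGradedDet f → f Y = f X := by
  let v : ∀ k : Idx r, 𝒜 (entryDegree γ r k i) := fun k => if h : k = s then ⟨u, h ▸ hu⟩ else 0
  refine ⟨colAdd i v * X, fun k j => ?_, fun f hf => ?_⟩
  · rw [colAdd_mul_apply]
    by_cases hk : k = s <;> simp [v, hk]
  · rw [hf.map_mul, hf.map_colAdd i v (dif_neg his), one_mul]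

/-- By induction on the number of indices not yet isolated. With `δ = f X - g X`, elimination at `s`
gives `X s s * δ = 0` by the induction hypothesis. Applied after adding `X i s` times row `i` to row
`s`, it gives `X i s * X i s * δ = 0`; this row operation is homogeneous because every degree is its
own negative. Then `f X * δ` and `g X * δ` vanish, so `δ² = 0`. -/
theorem IsGradedDet.eq_of_isReduced (hf : IsGradedDet f) (hg : IsGradedDet g)
    [IsReduced (𝒜 0)] : f = g := by
  have key : ∀ m : ℕ, ∀ S : Finset (Idx r), Sᶜ.card = m → ∀ X : M0 𝒜 γ r,
      (∀ i ∈ S, Isolated X.1 i) → f X = g X := by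
    intro m
    induction m with
    | zero =>
      intro S hS X hX
      refine hf.eq_of_isolated hg fun i => hX i ?_
      rw [Finset.card_eq_zero, Finset.compl_eq_empty_iff] at hS
      simp [hS]
    | succ m ih =>
      intro S hS X hX
      obtain ⟨s₀, hs₀⟩ := Finset.card_pos.mp (show 0 < Sᶜ.card by omega)
      rw [Finset.mem_compl] at hs₀
      have hpiv : ∀ Y : M0 𝒜 γ r, (∀ i ∈ S, Isolated Y.1 i) → ∀ s ∉ S,
          pivot Y s * (f Y - g Y) = 0 := by
        intro Y hY s hs
        obtain ⟨Y', hY', hfY'⟩ := exists_elim Y s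
        have h := ih (insert s S) (by
          rw [Finset.compl_insert, Finset.card_erase_of_mem (Finset.mem_compl.mpr hs), hS]
          rfl) Y' fun i hi => by
            rw [hY']
            by_cases his : i = s
            · subst his
              exact isolated_elim_self (pivot_comm Y i)
            · exact (hY i ((Finset.mem_insert.mp hi).resolve_left his)).elim his
        rw [hfY' f hf, hfY' g hg, ← sub_eq_zero, ← mul_sub] at h
        -- Reducedness turns `x^m * (f Y - g Y) = 0` into `x * (f Y - g Y) = 0`.
        apply eq_zero_of_pow_eq_zero (n := 2 * Fintype.card (Idx r) + 1)
        rw [mul_pow, pow_succ (f Y - g Y), mul_comm (_ ^ _) (f Y - g Y), ← mul_assoc,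
          pow_succ (pivot Y s), mul_assoc, mul_assoc]
        linear_combination (pivot Y s * (f Y - g Y) ^ (2 * Fintype.card (Idx r))) * h
      set δ := f X - g X with hδ
      have hpivX : ∀ s ∉ S, X.1 s s * (δ : A) = 0 := fun s hs =>
        congrArg Subtype.val (hpiv X hX s hs)
      have hent : ∀ i ∉ S, ∀ j ∉ S, X.1 i j * X.1 i j * δ = 0 := by
        intro i hi s hs
        by_cases his : i = s
        · subst his
          rw [mul_assoc, hpivX i hi, mul_zero]
        · have hdeg : -(γ i.1 : Deg n) + (γ s.1 : Deg n) = entryDegree γ r s i := by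
            rw [entryDegree, neg_eq_of_add_eq_zero_left (deg_add_self (γ i.1 : Deg n)),
              neg_eq_of_add_eq_zero_left (deg_add_self (γ s.1 : Deg n)), add_comm]
          obtain ⟨Y, hY, hfY⟩ := exists_add_row X his (hdeg ▸ X.2 i s)
          have hYS : ∀ k ∈ S, Isolated Y.1 k := by
            intro k hk j hj
            have hks : k ≠ s := fun h => hs (h ▸ hk)
            have hik : i ≠ k := fun h => hi (h ▸ hk)
            simp [hY, hks, hX k hk j hj, (hX k hk i hik).2]
          have h := congrArg Subtype.val (hpiv Y hYS s hs)
          rw [hfY f hf, hfY g hg, ← hδ] at h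
          change Y.1 s s * (δ : A) = 0 at h
          rwa [hY, if_pos rfl, add_mul, hpivX s hs, zero_add] at h
      have h1 := hf.mul_eq_zero_of_isolated hX hs₀ hent
      have h2 := hg.mul_eq_zero_of_isolated hX hs₀ hent
      have h3 : δ ^ 2 = 0 := by
        have h4 : δ ^ 2 = f X * δ - g X * δ := by rw [← sub_mul, ← hδ, sq]
        rw [h4, h1, h2, sub_zero]
      exact sub_eq_zero.mp (eq_zero_of_pow_eq_zero h3)
  funext X
  exact key _ ∅ rfl X (by simp)

end Reduced

/-! ### Maps that are linear in the rows or columns -/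

section Linear

/-- `f` is linear in each class of entries with the same label under `ρ`, the other entries being
fixed. Rows and columns are the classes for the two projections. -/
def LinearAlong (ρ : Idx r × Idx r → Idx r) (f : M0 𝒜 γ r → 𝒜 0) : Prop :=
  ∀ (i : Idx r) (a b : 𝒜 0) (X Y Z : M0 𝒜 γ r),
    (∀ k j, ρ (k, j) ≠ i → Z.1 k j = X.1 k j ∧ Z.1 k j = Y.1 k j) →
    (∀ k j, ρ (k, j) = i → Z.1 k j = (a : A) * X.1 k j + (b : A) * Y.1 k j) →
    f Z = a * f X + b * f Y

variable {f : M0 𝒜 γ r → 𝒜 0}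

theorem LinearInRows.linearAlong (hf : LinearInRows f) : LinearAlong Prod.fst f :=
  fun i a b X Y Z h h' => hf i a b X Y Z (fun k hk j => h k j hk) fun j => h' i j rfl

theorem LinearInColumns.linearAlong (hf : LinearInColumns f) : LinearAlong Prod.snd f :=
  fun j a b X Y Z h h' => hf j a b X Y Z (fun k hk i => h i k hk) fun i => h' i j rfl

/-- The matrix that agrees with `X` at the entries with label in `T` and with `W` elsewhere. -/
def splice (ρ : Idx r × Idx r → Idx r) (T : Finset (Idx r)) (X W : M0 𝒜 γ r) : M0 𝒜 γ r :=
  ⟨fun i j => if ρ (i, j) ∈ T then X.1 i j else W.1 i j, fun i j => by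
    change (if ρ (i, j) ∈ T then X.1 i j else W.1 i j) ∈ _
    split_ifs
    exacts [X.2 i j, W.2 i j]⟩

theorem splice_apply (ρ : Idx r × Idx r → Idx r) (T : Finset (Idx r)) (X W : M0 𝒜 γ r)
    (i j : Idx r) : (splice ρ T X W).1 i j = if ρ (i, j) ∈ T then X.1 i j else W.1 i j := rfl

/-- Expand linearly along one row (or column) of the line after the other. -/
theorem LinearAlong.polynomialOnLines {ρ : Idx r × Idx r → Idx r} (hf : LinearAlong ρ f) :
    PolynomialOnLines f := by
  intro X
  have key : ∀ (T : Finset (Idx r)) (W : M0 𝒜 γ r), ∃ F : Polynomial A, ∀ t : K,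
      (f (splice ρ T (line X t) W) : A) = evalAt A t F := by
    intro T
    induction T using Finset.induction_on with
    | empty =>
      intro W
      refine ⟨Polynomial.C (f W : A), fun t => ?_⟩
      rw [evalAt_C]
      congr 2
    | insert i T hi ih =>
      intro W
      -- Row `i` of the line is `(1 - t)` times that of the identity plus `t` times that of `X`.
      obtain ⟨F, hF⟩ := ih (splice ρ {i} 1 W)
      obtain ⟨G, hG⟩ := ih (splice ρ {i} X W)
      refine ⟨(1 - Polynomial.X) * F + Polynomial.X * G, fun t => ?_⟩
      have hc : ∀ c : K, ((algebraMap K (𝒜 0) c : 𝒜 0) : A) = algebraMap K A c := fun _ => rfl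
      rw [hf i (algebraMap K (𝒜 0) (1 - t)) (algebraMap K (𝒜 0) t)
        (splice ρ T (line X t) (splice ρ {i} 1 W)) (splice ρ T (line X t) (splice ρ {i} X W))]
      · have h : ∀ a b c d : 𝒜 0, ((a * b + c * d : 𝒜 0) : A) = a * b + c * d :=
          fun _ _ _ _ => rfl
        rw [h, hF, hG, hc, hc]
        simp
      · intro k j hkj
        simp [splice_apply, hkj]
      · intro k j hkj
        have hl : (line X t).1 k j = (1 - t) • (1 : Matrix (Idx r) (Idx r) A) k j + t • X.1 k j :=
          rfl
        rw [hc, hc, ← Algebra.smul_def, ← Algebra.smul_def]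
        simp [splice_apply, hkj, hi, hl]
  obtain ⟨F, hF⟩ := key Finset.univ 1
  refine ⟨F, fun t => ?_⟩
  rw [← hF]
  congr 2
  ext i j
  simp [splice_apply]

end Linear

end GradedDet

theorem theorem4p1 {K : Type*} [Field K] [CharZero K] {n : ℕ} (hn : 1 ≤ n)
    (γ : Fin (2 ^ (n - 1)) ≃ GradedDet.EvenDeg n) (r : Fin (2 ^ (n - 1)) → ℕ) :
    -- a polynomial with coefficients in `K` that serves for all algebras
    ∃ p : FreeAlgebra K (GradedDet.Idx r × GradedDet.Idx r),
      ∀ (A : Type*) [Ring A] [Algebra K A] (𝒜 : GradedDet.Deg n → Submodule K A)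
        [GradedAlgebra 𝒜] [GradedDet.GradedCommutative 𝒜], GradedDet.PurelyEven 𝒜 →
        ∃ Γdet : GradedDet.M0 𝒜 γ r → 𝒜 0,
          -- existence
          GradedDet.IsGradedDet Γdet ∧
          -- linearity and polynomiality
          GradedDet.LinearInRows Γdet ∧ GradedDet.LinearInColumns Γdet ∧
          GradedDet.IsGivenBy p Γdet ∧
          -- uniqueness among linear or polynomial maps, over every algebra
          (∀ f : GradedDet.M0 𝒜 γ r → 𝒜 0, GradedDet.IsGradedDet f →
            (GradedDet.LinearInRows f ∨ GradedDet.LinearInColumns f ∨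
              ∃ p' : FreeAlgebra K (GradedDet.Idx r × GradedDet.Idx r),
                GradedDet.IsGivenBy p' f) → f = Γdet) ∧
          -- uniqueness among all maps when the degree-zero part is reduced
          (IsReduced (𝒜 0) →
            ∀ f : GradedDet.M0 𝒜 γ r → 𝒜 0, GradedDet.IsGradedDet f → f = Γdet) ∧
          -- uniqueness among all maps, over every algebra, on matrices with a UDL decomposition
          (∀ f : GradedDet.M0 𝒜 γ r → 𝒜 0, GradedDet.IsGradedDet f →
            ∀ X, GradedDet.HasUDL X → f X = Γdet X) := by
  refine ⟨GradedDet.detPoly K γ r, fun A _ _ 𝒜 _ _ _ => ⟨GradedDet.gradedDet, ?_⟩⟩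
  have hd := GradedDet.isGradedDet_gradedDet (𝒜 := 𝒜) (γ := γ) (r := r)
  have hp := GradedDet.isGivenBy_gradedDet (𝒜 := 𝒜) (γ := γ) (r := r)
  refine ⟨hd, GradedDet.linearInRows_gradedDet, GradedDet.linearInColumns_gradedDet, hp,
    fun f hf h => ?_, fun _ f hf => hf.eq_of_isReduced hd, fun f hf X hX => ?_⟩
  · refine hf.eq_of_polynomialOnLines hd ?_ hp.polynomialOnLines
    rcases h with h | h | ⟨p', h⟩
    · exact h.linearAlong.polynomialOnLines
    · exact h.linearAlong.polynomialOnLines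
    · exact h.polynomialOnLines
  · obtain ⟨U, D, L, hU, hD, hL, rfl⟩ := hX
    rw [hf.map_mul, hf.map_mul, hd.map_mul, hd.map_mul, hf.unitriangular U (Or.inl hU),
      hf.blockDiagonal D hD, hf.unitriangular L (Or.inr hL), hd.unitriangular U (Or.inl hU),
      hd.blockDiagonal D hD, hd.unitriangular L (Or.inr hL)]
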